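/- Let $(\Omega,\mu)$ be a measure space, let the scalar field be $\mathbb R$ or $\mathbb C$, and let $X$ be a Banach lattice of measurable functions on $\Omega$: a linear space of measurable functions (modulo equality almost everywhere) with a complete norm $\|\cdot\|_X$ such that $f\in X$ and $|g|\le|f|$ a.e. with $g$ measurable imply $g\in X$ and $\|g\|_X\le\|f\|_X$. Suppose that (a) $X$ has the Fatou property: if $f_n\in X$, $\|f_n\|_X\le 1$ for all $n\in\mathbb N$, and $f_n$ converges almost everywhere to a measurable function $f$, then $f\in X$ and $\|f\|_X\le 1$; (b) $X$ is $q$-concave for some $1<q<\infty$: there is a constant $C$ such that $\left(\sum_{i=1}^n\|f_i\|_X^q\right)^{1/q}\le C\,\left\|\left(\sum_{i=1}^n|f_i|^q\right)^{1/q}\right\|_X$ for all $n$ and all $f_1,\dots,f_n\in X$. Then $X$ has order continuous norm: for every sequence $f_n\in X$ such that $\sup_n|f_n|\in X$ and $f_n\to0$ almost everywhere one has $\|f_n\|_X\to0$. -/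

import Mathlib

open MeasureTheory Filter Topology

/-- A Banach lattice (ideal space) of scalar measurable functions on the measure space `(Ω, μ)`:
a linear space of (classes modulo `μ`-a.e. equality of) measurable functions with a complete norm
such that `f ∈ X` and `|g| ≤ |f|` a.e. imply `g ∈ X` and `‖g‖ ≤ ‖f‖`. -/
structure BanachFunctionLattice (𝕜 : Type*) [RCLike 𝕜] {Ω : Type*} [MeasurableSpace Ω]
    (μ : Measure Ω) where
  /-- the functions that belong to the lattice -/
  carrier : Submodule 𝕜 (Ω →ₘ[μ] 𝕜)
  /-- the norm of the lattice -/
  norm : Seminorm 𝕜 carrier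
  /-- the norm is definite -/
  eq_zero_of_norm_eq_zero : ∀ f : carrier, norm f = 0 → f = 0
  /-- the norm is complete -/
  complete : ∀ u : ℕ → carrier,
    (∀ ε : ℝ, 0 < ε → ∃ N : ℕ, ∀ m ≥ N, ∀ n ≥ N, norm (u m - u n) < ε) →
      ∃ f : carrier, Tendsto (fun n => norm (u n - f)) atTop (𝓝 0)
  /-- the ideal property and the monotonicity of the norm -/
  ideal : ∀ (f : carrier) (g : Ω →ₘ[μ] 𝕜),
    (∀ᵐ ω ∂μ, ‖g ω‖ ≤ ‖(f : Ω →ₘ[μ] 𝕜) ω‖) →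
      ∃ hg : g ∈ carrier, norm ⟨g, hg⟩ ≤ norm f

namespace BanachFunctionLattice

variable {𝕜 : Type*} [RCLike 𝕜] {Ω : Type*} [MeasurableSpace Ω] {μ : Measure Ω}

/-- The Fatou property: the a.e. limit of a sequence in the closed unit ball of `X` belongs to `X`
and to its closed unit ball. -/
def HasFatouProperty (X : BanachFunctionLattice 𝕜 μ) : Prop :=
  ∀ (f : ℕ → X.carrier) (g : Ω →ₘ[μ] 𝕜),
    (∀ n, X.norm (f n) ≤ 1) →
    (∀ᵐ ω ∂μ, Tendsto (fun n => (f n : Ω →ₘ[μ] 𝕜) ω) atTop (𝓝 (g ω))) →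
      ∃ hg : g ∈ X.carrier, X.norm ⟨g, hg⟩ ≤ 1

/-- `q`-concavity: for some constant `C` and all finite families `f₁, …, fₙ` in `X`,
`(∑ ‖fᵢ‖^q)^(1/q) ≤ C ‖(∑ |fᵢ|^q)^(1/q)‖`. The function `F = (∑ |fᵢ|^q)^(1/q)` always lies in `X`,
since it is dominated by `∑ |fᵢ|` (for `q ≥ 1`). -/
def IsQConcave (X : BanachFunctionLattice 𝕜 μ) (q : ℝ) : Prop :=
  ∃ C : ℝ, ∀ (n : ℕ) (f : Fin n → X.carrier) (F : X.carrier),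
    (∀ᵐ ω ∂μ, (F : Ω →ₘ[μ] 𝕜) ω =
      (((∑ i, ‖(f i : Ω →ₘ[μ] 𝕜) ω‖ ^ q) ^ (1 / q) : ℝ) : 𝕜)) →
      (∑ i, X.norm (f i) ^ q) ^ (1 / q) ≤ C * X.norm F

/-- Order continuity of the norm: if `fₙ ∈ X`, `F = supₙ |fₙ|` (finite a.e.) belongs to `X` and
`fₙ → 0` a.e., then `‖fₙ‖ → 0`. -/
def HasOrderContinuousNorm (X : BanachFunctionLattice 𝕜 μ) : Prop :=
  ∀ (f : ℕ → X.carrier) (F : X.carrier),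
    (∀ᵐ ω ∂μ, BddAbove (Set.range fun n => ‖(f n : Ω →ₘ[μ] 𝕜) ω‖) ∧
      (F : Ω →ₘ[μ] 𝕜) ω = ((⨆ n, ‖(f n : Ω →ₘ[μ] 𝕜) ω‖ : ℝ) : 𝕜)) →
    (∀ᵐ ω ∂μ, Tendsto (fun n => (f n : Ω →ₘ[μ] 𝕜) ω) atTop (𝓝 0)) →
      Tendsto (fun n => X.norm (f n)) atTop (𝓝 0)

end BanachFunctionLattice

/-!
Concavity makes an order-bounded decreasing sequence `gₙ ≥ 0` Cauchy in norm: along any subsequence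
the increments have sum at most `g₀`, so the `q`-th powers of their norms are summable and the
increments cannot stay away from `0`. Completeness provides a norm limit; since order intervals are
norm closed, this limit lies below every `gₙ`, so it vanishes when `gₙ → 0` a.e. The general case
follows by applying this to the tail suprema `gₙ = sup_{k ≥ n} |fₖ|`.
-/

theorem sum_rpow_le_rpow_sum {ι : Type*} (s : Finset ι) {a : ι → ℝ} (ha : ∀ i ∈ s, 0 ≤ a i)
    {q : ℝ} (hq : 1 ≤ q) : ∑ i ∈ s, a i ^ q ≤ (∑ i ∈ s, a i) ^ q := by
  classical
  induction s using Finset.induction_on with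
  | empty => simp [Real.zero_rpow (zero_lt_one.trans_le hq).ne']
  | insert i s hi ih =>
    obtain ⟨hai, has⟩ := (Finset.forall_mem_insert ..).1 ha
    have hadd : a i ^ q + (∑ j ∈ s, a j) ^ q ≤ (a i + ∑ j ∈ s, a j) ^ q := by
      exact_mod_cast
        NNReal.add_rpow_le_rpow_add ⟨a i, hai⟩ ⟨∑ j ∈ s, a j, Finset.sum_nonneg has⟩ hq
    rw [Finset.sum_insert hi, Finset.sum_insert hi]
    exact (add_le_add_right (ih has) _).trans hadd

theorem tendsto_iSup_add_of_tendsto {α : Type*} [ConditionallyCompleteLinearOrder α]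
    [DenselyOrdered α] [TopologicalSpace α] [OrderTopology α] {a : ℕ → α} {l : α}
    (ha : Tendsto a atTop (𝓝 l)) : Tendsto (fun n => ⨆ k, a (n + k)) atTop (𝓝 l) := by
  have hbdd (n : ℕ) : BddAbove (Set.range fun k => a (n + k)) :=
    ha.bddAbove_range.mono (Set.range_comp_subset_range (n + ·) a)
  refine tendsto_order.2 ⟨fun b hb => ?_, fun b hb => ?_⟩
  · filter_upwards [ha.eventually_const_lt hb] with n hn
    exact hn.trans_le (le_ciSup (hbdd n) 0)
  · obtain ⟨c, hlc, hcb⟩ := exists_between hb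
    filter_upwards [eventually_forall_ge_atTop.2 (ha.eventually_lt_const hlc)] with n hn
    exact (ciSup_le fun k => (hn (n + k) (Nat.le_add_right n k)).le).trans_lt hcb

theorem exists_forall_lt_of_tendsto_succ {d : ℕ → ℕ → ℝ}
    (hd : ∀ φ : ℕ → ℕ, Monotone φ → Tendsto (fun k => d (φ k) (φ (k + 1))) atTop (𝓝 0))
    {ε : ℝ} (hε : 0 < ε) : ∃ N, ∀ n ≥ N, d N n < ε := by
  by_contra! hgap
  choose next hle hnext using hgap
  let φ : ℕ → ℕ := fun k => next^[k] 0
  have hsucc (k : ℕ) : φ (k + 1) = next (φ k) := Function.iterate_succ_apply' next k 0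
  have hmono : Monotone φ := monotone_nat_of_le_succ fun k => hsucc k ▸ hle (φ k)
  obtain ⟨k, hk⟩ := ((hd φ hmono).eventually_lt_const hε).exists
  exact (hnext (φ k)).not_gt (hsucc k ▸ hk)

section RCLike

open scoped ComplexOrder

theorem norm_eq_re_of_nonneg {𝕜 : Type*} [RCLike 𝕜] {z : 𝕜} (hz : 0 ≤ z) : ‖z‖ = RCLike.re z := by
  rw [← RCLike.ofReal_re (K := 𝕜) ‖z‖, RCLike.norm_of_nonneg' hz]

theorem sum_range_norm_sub_succ_le {𝕜 : Type*} [RCLike 𝕜] {a : ℕ → 𝕜} (ha : Antitone a)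
    (ha0 : ∀ n, 0 ≤ a n) (K : ℕ) : ∑ i ∈ Finset.range K, ‖a i - a (i + 1)‖ ≤ ‖a 0‖ := by
  calc ∑ i ∈ Finset.range K, ‖a i - a (i + 1)‖
      = ∑ i ∈ Finset.range K, (RCLike.re (a i) - RCLike.re (a (i + 1))) :=
        Finset.sum_congr rfl fun i _ => by
          rw [norm_eq_re_of_nonneg (sub_nonneg.2 (ha i.le_succ)), map_sub]
    _ = RCLike.re (a 0) - RCLike.re (a K) := Finset.sum_range_sub' (fun i => RCLike.re (a i)) K
    _ ≤ RCLike.re (a 0) := sub_le_self _ (RCLike.nonneg_iff.1 (ha0 K)).1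
    _ = ‖a 0‖ := (norm_eq_re_of_nonneg (ha0 0)).symm

end RCLike

namespace BanachFunctionLattice

open scoped ComplexOrder

variable {𝕜 : Type*} [RCLike 𝕜] {Ω : Type*} [MeasurableSpace Ω] {μ : Measure Ω}
  {X : BanachFunctionLattice 𝕜 μ}

theorem norm_le_norm_of_ae_le {f g : X.carrier}
    (h : ∀ᵐ ω ∂μ, ‖(f : Ω →ₘ[μ] 𝕜) ω‖ ≤ ‖(g : Ω →ₘ[μ] 𝕜) ω‖) : X.norm f ≤ X.norm g :=
  (X.ideal g f h).2

theorem coeFn_sub (f g : X.carrier) :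
    ∀ᵐ ω ∂μ, ((f - g : X.carrier) : Ω →ₘ[μ] 𝕜) ω =
      (f : Ω →ₘ[μ] 𝕜) ω - (g : Ω →ₘ[μ] 𝕜) ω :=
  AEEqFun.coeFn_sub (f : Ω →ₘ[μ] 𝕜) g

theorem exists_ae_eq_ofReal_of_abs_le {u : Ω → ℝ} (hu : AEMeasurable u μ) (F : X.carrier)
    (hle : ∀ᵐ ω ∂μ, |u ω| ≤ ‖(F : Ω →ₘ[μ] 𝕜) ω‖) :
    ∃ g : X.carrier, ∀ᵐ ω ∂μ, (g : Ω →ₘ[μ] 𝕜) ω = (u ω : 𝕜) := by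
  have hmeas : AEStronglyMeasurable (fun ω => (u ω : 𝕜)) μ :=
    RCLike.continuous_ofReal.comp_aestronglyMeasurable hu.aestronglyMeasurable
  have hcoe := AEEqFun.coeFn_mk _ hmeas
  obtain ⟨hmem, -⟩ := X.ideal F (AEEqFun.mk _ hmeas) (by
    filter_upwards [hcoe, hle] with ω hω hleω
    rwa [hω, RCLike.norm_ofReal])
  exact ⟨⟨_, hmem⟩, hcoe⟩

theorem ae_norm_le_of_tendsto_norm_sub {ι : Type*} {l : Filter ι} [l.NeBot]
    {g : ι → X.carrier} {v : X.carrier} {b : Ω →ₘ[μ] 𝕜}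
    (hlim : Tendsto (fun i => X.norm (g i - v)) l (𝓝 0))
    (hle : ∀ᶠ i in l, ∀ᵐ ω ∂μ, ‖(g i : Ω →ₘ[μ] 𝕜) ω‖ ≤ ‖b ω‖) :
    ∀ᵐ ω ∂μ, ‖(v : Ω →ₘ[μ] 𝕜) ω‖ ≤ ‖b ω‖ := by
  let excess : Ω → ℝ := fun ω => max (‖(v : Ω →ₘ[μ] 𝕜) ω‖ - ‖b ω‖) 0
  have hmeas : AEMeasurable excess μ :=
    (((v : Ω →ₘ[μ] 𝕜).measurable.norm.sub b.measurable.norm).max measurable_const).aemeasurable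
  obtain ⟨w, hw⟩ := exists_ae_eq_ofReal_of_abs_le hmeas v (.of_forall fun ω => by
    rw [abs_of_nonneg (le_max_right _ _)]
    exact max_le (sub_le_self _ (norm_nonneg _)) (norm_nonneg _))
  have hnorm : ∀ᵐ ω ∂μ, ‖(w : Ω →ₘ[μ] 𝕜) ω‖ = excess ω := by
    filter_upwards [hw] with ω hω
    rw [hω, RCLike.norm_of_nonneg (le_max_right _ _)]
  have hw_le : ∀ᶠ i in l, X.norm w ≤ X.norm (g i - v) := by
    filter_upwards [hle] with i hi
    refine norm_le_norm_of_ae_le ?_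
    filter_upwards [hi, hnorm, coeFn_sub (g i) v] with ω hiω hnormω hsub
    rw [hnormω, hsub]
    refine max_le ?_ (norm_nonneg _)
    calc ‖(v : Ω →ₘ[μ] 𝕜) ω‖ - ‖b ω‖
        ≤ ‖(v : Ω →ₘ[μ] 𝕜) ω‖ - ‖(g i : Ω →ₘ[μ] 𝕜) ω‖ := sub_le_sub_left hiω _
      _ ≤ ‖(g i : Ω →ₘ[μ] 𝕜) ω - (v : Ω →ₘ[μ] 𝕜) ω‖ := by
        rw [norm_sub_rev]
        exact norm_sub_norm_le _ _
  have hw0 : w = 0 :=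
    X.eq_zero_of_norm_eq_zero w ((ge_of_tendsto hlim hw_le).antisymm (apply_nonneg _ _))
  filter_upwards [hnorm, AEEqFun.coeFn_zero (μ := μ) (β := 𝕜)] with ω hω hzero
  have hexcess : excess ω = 0 := by
    rw [← hω, hw0, ZeroMemClass.coe_zero, hzero, Pi.zero_apply, norm_zero]
  exact sub_nonpos.1 (max_eq_right_iff.1 hexcess)

theorem exists_antitone_majorant {f : ℕ → X.carrier} {F : X.carrier}
    (hle : ∀ᵐ ω ∂μ, ∀ n, ‖(f n : Ω →ₘ[μ] 𝕜) ω‖ ≤ ‖(F : Ω →ₘ[μ] 𝕜) ω‖)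
    (hlim : ∀ᵐ ω ∂μ, Tendsto (fun n => (f n : Ω →ₘ[μ] 𝕜) ω) atTop (𝓝 0)) :
    ∃ g : ℕ → X.carrier,
      (∀ n, ∀ᵐ ω ∂μ, ‖(f n : Ω →ₘ[μ] 𝕜) ω‖ ≤ ‖(g n : Ω →ₘ[μ] 𝕜) ω‖) ∧
      (∀ᵐ ω ∂μ, Antitone fun n => (g n : Ω →ₘ[μ] 𝕜) ω) ∧
      ∀ᵐ ω ∂μ, Tendsto (fun n => (g n : Ω →ₘ[μ] 𝕜) ω) atTop (𝓝 0) := by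
  let u : ℕ → Ω → ℝ := fun n ω => ⨆ k, ‖(f (n + k) : Ω →ₘ[μ] 𝕜) ω‖
  have hmeas (n : ℕ) : Measurable (u n) :=
    Measurable.iSup fun k => (f (n + k) : Ω →ₘ[μ] 𝕜).measurable.norm
  have hu0 (n : ℕ) (ω : Ω) : 0 ≤ u n ω := Real.iSup_nonneg fun k => norm_nonneg _
  have hbdd : ∀ᵐ ω ∂μ, ∀ n, BddAbove (Set.range fun k => ‖(f (n + k) : Ω →ₘ[μ] 𝕜) ω‖) := by
    filter_upwards [hle] with ω hω n
    exact ⟨_, Set.forall_mem_range.2 fun k => hω (n + k)⟩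
  have huF (n : ℕ) : ∀ᵐ ω ∂μ, |u n ω| ≤ ‖(F : Ω →ₘ[μ] 𝕜) ω‖ := by
    filter_upwards [hle] with ω hω
    rw [abs_of_nonneg (hu0 n ω)]
    exact ciSup_le fun k => hω (n + k)
  choose g hg using fun n => exists_ae_eq_ofReal_of_abs_le (hmeas n).aemeasurable F (huF n)
  have hgu : ∀ᵐ ω ∂μ, ∀ n, (g n : Ω →ₘ[μ] 𝕜) ω = (u n ω : 𝕜) := ae_all_iff.2 hg
  refine ⟨g, fun n => ?_, ?_, ?_⟩
  · filter_upwards [hgu, hbdd] with ω hω hbddω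
    rw [hω, RCLike.norm_of_nonneg (hu0 n ω)]
    exact le_ciSup (hbddω n) 0
  · filter_upwards [hgu, hbdd] with ω hω hbddω
    refine antitone_nat_of_succ_le fun n => ?_
    rw [hω, hω, RCLike.ofReal_le_ofReal]
    refine ciSup_le fun k => ?_
    rw [add_assoc]
    exact le_ciSup (hbddω n) (1 + k)
  · filter_upwards [hgu, hlim] with ω hω hlimω
    simp only [hω]
    have hulim : Tendsto (fun n => u n ω) atTop (𝓝 0) :=
      tendsto_iSup_add_of_tendsto (tendsto_zero_iff_norm_tendsto_zero.1 hlimω)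
    exact RCLike.ofReal_zero (K := 𝕜) ▸ (RCLike.continuous_ofReal.tendsto 0).comp hulim

namespace IsQConcave

variable {q : ℝ}

theorem exists_sum_norm_rpow_le (hX : X.IsQConcave q) (hq : 1 ≤ q) :
    ∃ C : ℝ, ∀ (n : ℕ) (f : Fin n → X.carrier) (G : X.carrier),
      (∀ᵐ ω ∂μ, ∑ i, ‖(f i : Ω →ₘ[μ] 𝕜) ω‖ ≤ ‖(G : Ω →ₘ[μ] 𝕜) ω‖) →
        ∑ i, X.norm (f i) ^ q ≤ (C * X.norm G) ^ q := by
  obtain ⟨C, hC⟩ := hX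
  have hq0 : 0 < q := zero_lt_one.trans_le hq
  refine ⟨|C|, fun n f G hG => ?_⟩
  let u : Ω → ℝ := fun ω => (∑ i, ‖(f i : Ω →ₘ[μ] 𝕜) ω‖ ^ q) ^ (1 / q)
  have hu0 (ω : Ω) : 0 ≤ u ω := by positivity
  have hmeas : Measurable u := by
    have (i : Fin n) := (f i : Ω →ₘ[μ] 𝕜).measurable
    fun_prop
  have huG : ∀ᵐ ω ∂μ, u ω ≤ ‖(G : Ω →ₘ[μ] 𝕜) ω‖ := by
    filter_upwards [hG] with ω hω
    calc u ω ≤ ((∑ i, ‖(f i : Ω →ₘ[μ] 𝕜) ω‖) ^ q) ^ (1 / q) :=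
          Real.rpow_le_rpow (by positivity)
            (sum_rpow_le_rpow_sum _ (fun i _ => norm_nonneg _) hq) (by positivity)
      _ = ∑ i, ‖(f i : Ω →ₘ[μ] 𝕜) ω‖ := by
          rw [one_div, Real.rpow_rpow_inv (by positivity) hq0.ne']
      _ ≤ ‖(G : Ω →ₘ[μ] 𝕜) ω‖ := hω
  obtain ⟨F, hF⟩ := exists_ae_eq_ofReal_of_abs_le hmeas.aemeasurable G (by
    simpa only [abs_of_nonneg (hu0 _)] using huG)
  have hFG : X.norm F ≤ X.norm G := norm_le_norm_of_ae_le (by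
    filter_upwards [hF, huG] with ω hω huGω
    rwa [hω, RCLike.norm_of_nonneg (hu0 ω)])
  have hroot : (∑ i, X.norm (f i) ^ q) ^ (1 / q) ≤ |C| * X.norm G :=
    (hC n f F hF).trans
      (mul_le_mul (le_abs_self C) hFG (apply_nonneg _ _) (abs_nonneg C))
  rwa [one_div, Real.rpow_inv_le_iff_of_pos (by positivity) (by positivity) hq0] at hroot

theorem tendsto_norm_zero_of_sum_le (hX : X.IsQConcave q) (hq : 1 ≤ q) {f : ℕ → X.carrier}
    {G : X.carrier} (hG : ∀ᵐ ω ∂μ, ∀ n,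
      ∑ i ∈ Finset.range n, ‖(f i : Ω →ₘ[μ] 𝕜) ω‖ ≤ ‖(G : Ω →ₘ[μ] 𝕜) ω‖) :
    Tendsto (fun n => X.norm (f n)) atTop (𝓝 0) := by
  obtain ⟨C, hC⟩ := hX.exists_sum_norm_rpow_le hq
  have hq0 : 0 < q := zero_lt_one.trans_le hq
  have hsummable : Summable fun n => X.norm (f n) ^ q :=
    summable_of_sum_range_le (fun n => by positivity) fun n => by
      rw [← Fin.sum_univ_eq_sum_range fun i => X.norm (f i) ^ q]
      refine hC n (fun i => f i) G ?_
      filter_upwards [hG] with ω hω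
      rw [Fin.sum_univ_eq_sum_range fun i => ‖(f i : Ω →ₘ[μ] 𝕜) ω‖]
      exact hω n
  have hroot := hsummable.tendsto_atTop_zero.rpow_const (p := q⁻¹) (.inr (by positivity))
  simpa only [Real.rpow_rpow_inv (apply_nonneg X.norm _) hq0.ne',
    Real.zero_rpow (inv_pos.2 hq0).ne'] using hroot

theorem cauchy_of_antitone (hX : X.IsQConcave q) (hq : 1 ≤ q) {g : ℕ → X.carrier}
    (hanti : ∀ᵐ ω ∂μ, Antitone fun n => (g n : Ω →ₘ[μ] 𝕜) ω)
    (hnonneg : ∀ᵐ ω ∂μ, ∀ n, 0 ≤ (g n : Ω →ₘ[μ] 𝕜) ω) {ε : ℝ} (hε : 0 < ε) :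
    ∃ N, ∀ m ≥ N, ∀ n ≥ N, X.norm (g m - g n) < ε := by
  have hincrement (φ : ℕ → ℕ) (hφ : Monotone φ) :
      Tendsto (fun k => X.norm (g (φ k) - g (φ (k + 1)))) atTop (𝓝 0) := by
    refine hX.tendsto_norm_zero_of_sum_le hq (G := g (φ 0)) ?_
    filter_upwards [hanti, hnonneg, ae_all_iff.2 fun k => coeFn_sub (g (φ k)) (g (φ (k + 1)))]
      with ω hantiω hnonnegω hsub K
    simp only [hsub]
    exact sum_range_norm_sub_succ_le (hantiω.comp_monotone hφ) (fun k => hnonnegω (φ k)) K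
  obtain ⟨N, hN⟩ := exists_forall_lt_of_tendsto_succ (d := fun m n => X.norm (g m - g n))
    hincrement (half_pos hε)
  refine ⟨N, fun m hm n hn => ?_⟩
  calc X.norm (g m - g n) = X.norm ((g N - g n) - (g N - g m)) :=
        congrArg X.norm (sub_sub_sub_cancel_left (g n) (g m) (g N)).symm
    _ ≤ X.norm (g N - g n) + X.norm (g N - g m) := map_sub_le_add X.norm (g N - g n) (g N - g m)
    _ < ε / 2 + ε / 2 := add_lt_add (hN n hn) (hN m hm)
    _ = ε := add_halves ε

theorem tendsto_norm_zero_of_antitone (hX : X.IsQConcave q) (hq : 1 ≤ q) {g : ℕ → X.carrier}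
    (hanti : ∀ᵐ ω ∂μ, Antitone fun n => (g n : Ω →ₘ[μ] 𝕜) ω)
    (hlim : ∀ᵐ ω ∂μ, Tendsto (fun n => (g n : Ω →ₘ[μ] 𝕜) ω) atTop (𝓝 0)) :
    Tendsto (fun n => X.norm (g n)) atTop (𝓝 0) := by
  have hnonneg : ∀ᵐ ω ∂μ, ∀ n, 0 ≤ (g n : Ω →ₘ[μ] 𝕜) ω := by
    filter_upwards [hanti, hlim] with ω hantiω hlimω using hantiω.le_of_tendsto hlimω
  obtain ⟨v, hv⟩ := X.complete g fun _ hε => hX.cauchy_of_antitone hq hanti hnonneg hε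
  have hv_le (n : ℕ) : ∀ᵐ ω ∂μ, ‖(v : Ω →ₘ[μ] 𝕜) ω‖ ≤ ‖(g n : Ω →ₘ[μ] 𝕜) ω‖ := by
    refine ae_norm_le_of_tendsto_norm_sub hv ?_
    filter_upwards [eventually_ge_atTop n] with m hm
    filter_upwards [hanti, hnonneg] with ω hantiω hnonnegω
    rw [norm_eq_re_of_nonneg (hnonnegω m), norm_eq_re_of_nonneg (hnonnegω n)]
    exact RCLike.re_le_re (hantiω hm)
  have hv0 : v = 0 := by
    ext
    filter_upwards [hlim, ae_all_iff.2 hv_le, AEEqFun.coeFn_zero (μ := μ) (β := 𝕜)]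
      with ω hlimω hleω hzero
    rw [ZeroMemClass.coe_zero, hzero, Pi.zero_apply]
    exact norm_le_zero_iff.1 (ge_of_tendsto' (tendsto_zero_iff_norm_tendsto_zero.1 hlimω) hleω)
  subst hv0
  exact hv.congr fun n => congrArg X.norm (sub_zero (g n))

end IsQConcave

end BanachFunctionLattice

theorem proposition6_general {𝕜 : Type*} [RCLike 𝕜] {Ω : Type*} [MeasurableSpace Ω]
    {μ : Measure Ω} (X : BanachFunctionLattice 𝕜 μ) {q : ℝ} (hq : 1 ≤ q) (hX : X.IsQConcave q) :
    X.HasOrderContinuousNorm := by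
  intro f F hF hf
  have hle : ∀ᵐ ω ∂μ, ∀ n, ‖(f n : Ω →ₘ[μ] 𝕜) ω‖ ≤ ‖(F : Ω →ₘ[μ] 𝕜) ω‖ := by
    filter_upwards [hF] with ω ⟨hbdd, hsup⟩ n
    rw [hsup, RCLike.norm_of_nonneg (Real.iSup_nonneg fun k => norm_nonneg _)]
    exact le_ciSup hbdd n
  obtain ⟨g, hfg, hanti, hlim⟩ := BanachFunctionLattice.exists_antitone_majorant hle hf
  exact squeeze_zero (fun n => apply_nonneg _ _)
    (fun n => BanachFunctionLattice.norm_le_norm_of_ae_le (hfg n))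
    (hX.tendsto_norm_zero_of_antitone hq hanti hlim)

theorem proposition6 {𝕜 : Type*} [RCLike 𝕜] {Ω : Type*} [MeasurableSpace Ω] {μ : Measure Ω}
    (X : BanachFunctionLattice 𝕜 μ) (hFatou : X.HasFatouProperty)
    (hconcave : ∃ q : ℝ, 1 < q ∧ X.IsQConcave q) :
    X.HasOrderContinuousNorm :=
  let ⟨_, hq, hX⟩ := hconcave
  proposition6_general X hq.le hX
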